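/- Let $\lambda,\mu\ge 0$ be real numbers, not both zero. For a function $m$ on $\mathbb R^2$ let $m(D)f=(m\hat f)^\vee$ denote the Fourier multiplier operator, with domain $\{f\in L^2(\mathbb R^2): m\hat f\in L^2(\mathbb R^2)\}$, where $\hat f(\xi,\eta)=\int f(x,y)e^{-2\pi i(x\xi+y\eta)}\,dx\,dy$; here $D_x^{s}$, $\partial_x$ and $\partial_y$ have the symbols $(2\pi|\xi|)^s$, $2\pi i\xi$ and $2\pi i\eta$. Let $X^{1/2}$ be the space of all (complex-valued) $f\in L^2(\mathbb R^2)$ with $D_x^{1/2}f$, $\sqrt\lambda\,D_x^{-1/2}\partial_yf$ and $\sqrt\mu\,\partial_x^{-1}\partial_yf$ in $L^2(\mathbb R^2)$, normed by $$\|f\|_{X^{1/2}}^2=\|f\|_{L^2}^2+\|D_x^{1/2}f\|_{L^2}^2+\lambda\|D_x^{-1/2}\partial_yf\|_{L^2}^2+\mu\|\partial_x^{-1}\partial_yf\|_{L^2}^2,$$ where a term with coefficient $0$ is omitted (and imposes no condition on $f$). Let $$0\le p<4\ \text{ if }\lambda>0,\qquad 0\le p<\tfrac43\ \text{ if }\lambda=0.$$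 Then the embedding $X^{1/2}\hookrightarrow L^p_{loc}(\mathbb R^2)$ is (well defined and) compact: every $f\in X^{1/2}$ belongs to $L^p(B_R)$ for every $R>0$, where $B_R$ is the ball of radius $R$ centred at the origin, and every bounded sequence $(u_n)$ in $X^{1/2}$ has a subsequence $(u_{n_k})$ for which there is a function $u\in L^p_{loc}(\mathbb R^2)$ such that $u_{n_k}\to u$ strongly in $L^p(B_R)$ for every $R>0$. (For $0<p<1$, convergence in $L^p(B_R)$ means $\int_{B_R}|u_{n_k}-u|^p\to0$; $L^0(B_R)$ is the space of measurable functions on $B_R$ with convergence in measure.) -/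

import Mathlib

open MeasureTheory

/-- The plane `ℝ²` with its Euclidean structure; a point is `(x, y) = (z 0, z 1)`, a frequency
`(ξ, η) = (ζ 0, ζ 1)`. -/
abbrev Plane : Type := EuclideanSpace ℝ (Fin 2)

/-- The Hilbert space `L²(ℝ²)` of complex-valued functions. -/
abbrev L2Plane : Type := Lp ℂ 2 (volume : Measure Plane)

/-- The `g ∈ L²` with `m g ∈ L²`. -/
noncomputable def mulDomain (m : Plane → ℂ) : Submodule ℂ L2Plane where
  carrier := {g | MemLp (fun ζ => m ζ * g ζ) 2 volume}
  zero_mem' := by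
    have h : (fun ζ => m ζ * (0 : L2Plane) ζ) =ᵐ[volume] fun _ => 0 := by
      filter_upwards [Lp.coeFn_zero ℂ 2 (volume : Measure Plane)] with ζ hζ
      rw [hζ]
      simp
    exact (memLp_congr_ae h).2 MemLp.zero'
  add_mem' := by
    intro f g hf hg
    refine (memLp_congr_ae ?_).2 (MemLp.add hf hg)
    filter_upwards [Lp.coeFn_add f g] with ζ hζ
    rw [hζ]
    simp only [Pi.add_apply, mul_add]
  smul_mem' := by
    intro c f hf
    refine (memLp_congr_ae ?_).2 (MemLp.const_smul hf c)
    filter_upwards [Lp.coeFn_smul c f] with ζ hζ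
    rw [hζ]
    simp only [Pi.smul_apply, smul_eq_mul, mul_left_comm]

theorem mem_mulDomain {m : Plane → ℂ} {g : L2Plane} :
    g ∈ mulDomain m ↔ MemLp (fun ζ => m ζ * g ζ) 2 volume := Iff.rfl

/-- The multiplication operator `g ↦ m g` from its maximal domain to `L²`. -/
noncomputable def mulMap (m : Plane → ℂ) : mulDomain m →ₗ[ℂ] L2Plane where
  toFun g := (mem_mulDomain.1 g.2).toLp (fun ζ => m ζ * g.1 ζ)
  map_add' f g := by
    apply Lp.ext
    filter_upwards [(mem_mulDomain.1 (f + g).2).coeFn_toLp, (mem_mulDomain.1 f.2).coeFn_toLp,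
      (mem_mulDomain.1 g.2).coeFn_toLp, Lp.coeFn_add f.1 g.1,
      Lp.coeFn_add ((mem_mulDomain.1 f.2).toLp (fun ζ => m ζ * f.1 ζ))
        ((mem_mulDomain.1 g.2).toLp (fun ζ => m ζ * g.1 ζ))] with ζ h1 h2 h3 h4 h5
    rw [h1, h5, Pi.add_apply, h2, h3, Submodule.coe_add, h4, Pi.add_apply, mul_add]
  map_smul' c f := by
    apply Lp.ext
    filter_upwards [(mem_mulDomain.1 (c • f).2).coeFn_toLp, (mem_mulDomain.1 f.2).coeFn_toLp,
      Lp.coeFn_smul c f.1,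
      Lp.coeFn_smul c ((mem_mulDomain.1 f.2).toLp (fun ζ => m ζ * f.1 ζ))] with ζ h1 h2 h4 h5
    rw [h1, RingHom.id_apply, h5, Pi.smul_apply, h2, Submodule.coe_smul, h4, Pi.smul_apply,
      smul_eq_mul, smul_eq_mul, mul_left_comm]

/-- The Fourier transform `L²(ℝ²) → L²(ℝ²)`, with `f̂ ζ = ∫ f z exp (-2πi z·ζ) dz`. -/
noncomputable abbrev fourierL2 : L2Plane ≃ₗᵢ[ℂ] L2Plane := Lp.fourierTransformₗᵢ Plane ℂ

/-- The (unbounded) Fourier multiplier operator `f ↦ (m f̂)^∨` on `L²(ℝ²)`. Its domain consists of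
the `f ∈ L²` with `m f̂ ∈ L²`. -/
noncomputable def fourierMultiplier (m : Plane → ℂ) : L2Plane →ₗ.[ℂ] L2Plane where
  domain := (mulDomain m).comap fourierL2.toLinearEquiv.toLinearMap
  toFun := fourierL2.symm.toLinearEquiv.toLinearMap ∘ₗ mulMap m ∘ₗ
    fourierL2.toLinearEquiv.toLinearMap.restrict
      (p := (mulDomain m).comap fourierL2.toLinearEquiv.toLinearMap) (fun _ h => h)

theorem mem_fourierMultiplier_domain {m : Plane → ℂ} {f : L2Plane} :
    f ∈ (fourierMultiplier m).domain ↔ MemLp (fun ζ => m ζ * fourierL2 f ζ) 2 volume := Iff.rfl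

theorem fourierL2_fourierMultiplier (m : Plane → ℂ) (f : (fourierMultiplier m).domain) :
    fourierL2 (fourierMultiplier m f) =
      (mem_fourierMultiplier_domain.1 f.2).toLp (fun ζ => m ζ * fourierL2 f.1 ζ) :=
  fourierL2.apply_symm_apply _

/-- The symbol of `D_xˢ`: `(2π|ξ|)ˢ`. -/
noncomputable def symbolDx (s : ℝ) (ζ : Plane) : ℂ := (((2 * Real.pi * |ζ 0|) ^ s : ℝ) : ℂ)

/-- The symbol of `∂_x`: `2πiξ`. -/
noncomputable def symbolPx (ζ : Plane) : ℂ := 2 * Real.pi * Complex.I * (ζ 0 : ℂ)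

/-- The symbol of `∂_y`: `2πiη`. -/
noncomputable def symbolPy (ζ : Plane) : ℂ := 2 * Real.pi * Complex.I * (ζ 1 : ℂ)

/-- The operator `D_x^{1/2}` on `L²`. -/
noncomputable def opDxHalf : L2Plane →ₗ.[ℂ] L2Plane :=
  fourierMultiplier (symbolDx (1 / 2))

/-- The operator `c D_x^{-1/2} ∂_y` on `L²` (everywhere defined and zero if `c = 0`). -/
noncomputable def opDxNegHalfPy (c : ℝ) : L2Plane →ₗ.[ℂ] L2Plane :=
  fourierMultiplier fun ζ => (c : ℂ) * (symbolDx (-1 / 2) ζ * symbolPy ζ)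

/-- The operator `c ∂_x^{-1} ∂_y` on `L²` (everywhere defined and zero if `c = 0`). -/
noncomputable def opPxInvPy (c : ℝ) : L2Plane →ₗ.[ℂ] L2Plane :=
  fourierMultiplier fun ζ => (c : ℂ) * ((symbolPx ζ)⁻¹ * symbolPy ζ)

/-- The linear subspace of `L²` underlying `X^{1/2}`: the `f ∈ L²` for which
`D_x^{1/2} f`, `√λ D_x^{-1/2} f_y` and `√μ ∂_x^{-1} f_y` are in `L²`. -/
noncomputable def xHalfSubmodule (lam mu : ℝ) : Submodule ℂ L2Plane :=
  opDxHalf.domain ⊓ (opDxNegHalfPy (Real.sqrt lam)).domain ⊓ (opPxInvPy (Real.sqrt mu)).domain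

/-- The space `X^{1/2}`, as a type of its own: it carries the norm defined below, and not the norm
of `L²`. -/
def XHalf (lam mu : ℝ) : Type := ↥(xHalfSubmodule lam mu)

namespace XHalf

variable (lam mu : ℝ)

noncomputable instance : AddCommGroup (XHalf lam mu) :=
  inferInstanceAs (AddCommGroup ↥(xHalfSubmodule lam mu))

noncomputable instance : Module ℂ (XHalf lam mu) :=
  inferInstanceAs (Module ℂ ↥(xHalfSubmodule lam mu))

variable {lam mu} in
/-- The inclusion of `X^{1/2}` in `L²`. -/
def toL2 (f : XHalf lam mu) : L2Plane := f.1

/-- The linear map `f ↦ (f, D_x^{1/2} f, √λ D_x^{-1/2} f_y, √μ ∂_x^{-1} f_y)`. -/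
noncomputable def components : XHalf lam mu →ₗ[ℂ] PiLp 2 (fun _ : Fin 4 => L2Plane) where
  toFun f := WithLp.toLp 2 ![f.1, opDxHalf ⟨f.1, f.2.1.1⟩,
    opDxNegHalfPy (Real.sqrt lam) ⟨f.1, f.2.1.2⟩, opPxInvPy (Real.sqrt mu) ⟨f.1, f.2.2⟩]
  map_add' f g := by
    ext1 i
    fin_cases i
    · rfl
    · exact opDxHalf.map_add ⟨f.1, f.2.1.1⟩ ⟨g.1, g.2.1.1⟩
    · exact (opDxNegHalfPy (Real.sqrt lam)).map_add ⟨f.1, f.2.1.2⟩ ⟨g.1, g.2.1.2⟩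
    · exact (opPxInvPy (Real.sqrt mu)).map_add ⟨f.1, f.2.2⟩ ⟨g.1, g.2.2⟩
  map_smul' c f := by
    ext1 i
    fin_cases i
    · rfl
    · exact opDxHalf.map_smul c ⟨f.1, f.2.1.1⟩
    · exact (opDxNegHalfPy (Real.sqrt lam)).map_smul c ⟨f.1, f.2.1.2⟩
    · exact (opPxInvPy (Real.sqrt mu)).map_smul c ⟨f.1, f.2.2⟩

theorem components_injective : Function.Injective (components lam mu) := by
  intro f g h
  have h0 := congrArg (fun v : PiLp 2 (fun _ : Fin 4 => L2Plane) => v 0) h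
  exact Subtype.ext h0

/-- The norm of `X^{1/2}`; see `XHalf.norm_sq`. -/
noncomputable instance : NormedAddCommGroup (XHalf lam mu) :=
  NormedAddCommGroup.induced (XHalf lam mu) (PiLp 2 (fun _ : Fin 4 => L2Plane))
    (components lam mu) (components_injective lam mu)

noncomputable instance : NormedSpace ℂ (XHalf lam mu) :=
  NormedSpace.induced ℂ (XHalf lam mu) (PiLp 2 (fun _ : Fin 4 => L2Plane)) (components lam mu)

variable {lam mu} in
theorem norm_sq (f : XHalf lam mu) :
    ‖f‖ ^ 2 = ‖f.toL2‖ ^ 2 + ‖opDxHalf ⟨f.1, f.2.1.1⟩‖ ^ 2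
      + ‖opDxNegHalfPy (Real.sqrt lam) ⟨f.1, f.2.1.2⟩‖ ^ 2
      + ‖opPxInvPy (Real.sqrt mu) ⟨f.1, f.2.2⟩‖ ^ 2 := by
  change ‖components lam mu f‖ ^ 2 = _
  rw [PiLp.norm_sq_eq_of_L2, Fin.sum_univ_four]
  rfl

end XHalf

/-- Convergence in `Lᵖ(ν)`, `0 ≤ p`: for `p > 0` it is `‖fₙ - g‖_p → 0`, where
`‖h‖_p = (∫ |h|ᵖ)^{1/p}` also if `p < 1`, and `L⁰` carries convergence in measure. -/
def TendstoLp (p : ℝ) (ν : Measure Plane) (f : ℕ → Plane → ℂ) (g : Plane → ℂ) : Prop :=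
  if p = 0 then TendstoInMeasure ν f Filter.atTop g
  else Filter.Tendsto (fun n => eLpNorm (f n - g) (ENNReal.ofReal p) ν) Filter.atTop (nhds 0)

/-!
The space `X^{1/2}` embeds in an isotropic Sobolev space `H^s(ℝ²)` with `0 < s < 1`, and then
`H^s(ℝ²)` embeds compactly in `L^p_loc` for `p < 2 / (1 - s)`.

If `λ > 0`, put `W = 1 + |ξ|^{1/2} + |η| / |ξ|^{1/2}`, which the symbols of the norm control. Then
`|η| = |ξ|^{1/2} (|η| / |ξ|^{1/2}) ≤ W²`, so `(1 + |ζ|)^{1/2} ≲ W`: one can take `s = 1/2`, and every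
`p < 4` is allowed. If `λ = 0 < μ`, the symbols control `W = 1 + |ξ|^{1/2} + |η| / |ξ|`, and
`|η| = |ξ| (|η| / |ξ|) ≤ W³` gives `s = 1/3`; every `p < 3`, in particular every `p < 4/3`, is
allowed. See `exists_weight_bound` and
`XHalf.exists_eq_bessel`; the latter writes `f̂ = (1 + |ζ|)^{-s} k` with `‖k‖_2 ≲ ‖f‖`.

For the embedding of `H^s`, split `f` at frequency `A`. By the Cauchy-Schwarz inequality the part of
low frequency is bounded by a multiple of `A^{1-s} ‖k‖_2`, and the part of high frequency has `L²`
norm at most `A^{-s} ‖k‖_2`. Choosing `A` so that the first is at most `t / 2` and applying Chebyshev's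
inequality to the second gives the weak-type bound `|{|f| > t}| ≤ C t^{-r}` with `r = 2 / (1 - s)`
(`exists_weakType_bound`), hence local `L^p` bounds for `p < r`.

For compactness, pass to a weakly convergent subsequence of the `k n`. The part of low frequency, at
each point, is the inner product of `k n` with a fixed element of `L²`, so it converges everywhere,
while the part of high frequency is uniformly small in `L²`. Hence the sequence converges in measure
on balls (`tendsto_meas_of_weakly_tendsto_zero`). The layer cake formula and dominated convergence
upgrade this, with the weak-type bound, to convergence in `L^p` (`tendsto_eLpNorm_of_weakType`).
-/

open Filter Topology ENNReal FourierTransform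

/-! ### The inverse Fourier transform on `L¹ ∩ L²` and weak sequential compactness -/

/-- On `L¹ ∩ L²` the inverse Fourier transform of `L²` is given by the integral. Both sides have the
same pairing with every test function, as both transforms are self-adjoint against Schwartz
functions. -/
theorem fourierL2_symm_coe_ae_eq_fourierInv (g : L2Plane) (hg : Integrable (g : Plane → ℂ)) :
    (fourierL2.symm g : Plane → ℂ) =ᵐ[volume] 𝓕⁻ (g : Plane → ℂ) := by
  have hcont : Continuous (𝓕⁻ (g : Plane → ℂ)) := by
    refine VectorFourier.fourierIntegral_continuous (L := -innerₗ Plane)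
      Real.continuous_fourierChar ?_ hg
    exact continuous_inner.neg
  refine ae_eq_of_integral_contDiff_smul_eq
    ((Lp.memLp _).locallyIntegrable (by norm_num)) hcont.locallyIntegrable ?_
  intro φ φ_smooth φ_cpt
  have h1 : HasCompactSupport (Complex.ofRealCLM ∘ φ) := φ_cpt.comp_left rfl
  have h2 : ContDiff ℝ ((⊤ : ℕ∞) : WithTop ℕ∞) (Complex.ofRealCLM ∘ φ) := by fun_prop
  set ψ : SchwartzMap Plane ℂ := h1.toSchwartzMap h2
  have hψ : ∀ x, ψ x = (φ x : ℂ) := fun x => rfl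
  have e1 : ∫ x, ψ x • (fourierL2.symm g : Plane → ℂ) x = ∫ x, (𝓕⁻ ψ) x • (g : Plane → ℂ) x := by
    have h := congrArg (fun T : TemperedDistribution Plane ℂ => T ψ)
      (Lp.fourierInv_toTemperedDistribution_eq g)
    simp only [TemperedDistribution.fourierInv_apply, Lp.toTemperedDistribution_apply] at h
    exact h.symm
  have e2 : ∫ x, (𝓕⁻ ψ) x • (g : Plane → ℂ) x = ∫ x, ψ x • 𝓕⁻ (g : Plane → ℂ) x := by
    have h := VectorFourier.integral_fourierIntegral_smul_eq_flip (μ := (volume : Measure Plane))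
      (ν := (volume : Measure Plane)) (L := -innerₗ Plane) Real.continuous_fourierChar
      (continuous_inner.neg) ψ.integrable hg
    have hflip : (-innerₗ Plane).flip = -innerₗ Plane := by
      ext x y
      simp [real_inner_comm]
    rw [hflip] at h
    rw [SchwartzMap.fourierInv_coe]
    exact h
  have h := e1.trans e2
  simpa only [hψ, Complex.coe_smul] using h

/-- A bounded sequence in a separable Hilbert space has a weakly convergent subsequence: this is the
sequential Banach-Alaoglu theorem, read through the Riesz isomorphism. -/
theorem exists_subseq_weakly_tendsto {H : Type*} [NormedAddCommGroup H] [InnerProductSpace ℂ H]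
    [CompleteSpace H] [TopologicalSpace.SeparableSpace H] {x : ℕ → H} {C : ℝ}
    (hx : ∀ n, ‖x n‖ ≤ C) :
    ∃ φ : ℕ → ℕ, StrictMono φ ∧ ∃ a : H, ∀ h : H,
      Tendsto (fun n => inner ℂ (x (φ n)) h) atTop (𝓝 (inner ℂ a h)) := by
  obtain ⟨a, -, φ, hφ, hlim⟩ := WeakDual.isSeqCompact_closedBall ℂ H 0 C
    (x := fun n => StrongDual.toWeakDual (InnerProductSpace.toDual ℂ H (x n)))
    (fun n => by simpa using hx n)
  refine ⟨φ, hφ, (InnerProductSpace.toDual ℂ H).symm (WeakDual.toStrongDual a), fun h => ?_⟩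
  have := ((WeakDual.eval_continuous (𝕜 := ℂ) h).tendsto a).comp hlim
  simpa [Function.comp_def] using! this

/-! ### From weak-type bounds and convergence in measure to `Lᵖ` -/

section WeakType

variable {α : Type*} [MeasurableSpace α] {ν : Measure α} {C p r : ℝ}

/-- A bound for the integrand `ν {t < ‖f‖} t^{p-1}` of the layer cake formula, for `f` with
`ν {t < ‖f‖} ≤ C t^{-r}`. The first term of the minimum is the better one near `t = 0`, the second
one near `t = ∞`. -/
noncomputable def layerMajorant (ν : Measure α) (C p r t : ℝ) : ℝ≥0∞ :=
  min (ν Set.univ) (ENNReal.ofReal (C * t ^ (-r))) * ENNReal.ofReal (t ^ (p - 1))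

theorem lintegral_enorm_rpow_eq_lintegral_meas {f : α → ℂ} (hf : AEStronglyMeasurable f ν)
    (hp : 0 < p) :
    ∫⁻ x, ‖f x‖ₑ ^ p ∂ν =
      ENNReal.ofReal p * ∫⁻ t in Set.Ioi 0, ν {x | t < ‖f x‖} * ENNReal.ofReal (t ^ (p - 1)) := by
  rw [← lintegral_rpow_eq_lintegral_meas_lt_mul ν (ae_of_all _ fun x => norm_nonneg (f x))
    hf.norm.aemeasurable hp]
  refine lintegral_congr fun x => ?_
  rw [← ofReal_norm, ENNReal.ofReal_rpow_of_nonneg (norm_nonneg _) hp.le]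

theorem meas_mul_le_layerMajorant {f : α → ℂ}
    (hw : ∀ t : ℝ, 0 < t → ν {x | t < ‖f x‖} ≤ ENNReal.ofReal (C * t ^ (-r))) {t : ℝ} (ht : 0 < t) :
    ν {x | t < ‖f x‖} * ENNReal.ofReal (t ^ (p - 1)) ≤ layerMajorant ν C p r t :=
  mul_le_mul_left (le_min (measure_mono (Set.subset_univ _)) (hw t ht)) _

variable [IsFiniteMeasure ν]

theorem lintegral_layerMajorant_ne_top (hC : 0 ≤ C) (hp : 0 < p) (hpr : p < r) :
    ∫⁻ t in Set.Ioi 0, layerMajorant ν C p r t ≠ ∞ := by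
  have hsplit : Set.Ioi (0 : ℝ) = Set.Ioo 0 1 ∪ Set.Ici 1 := by
    ext t
    simp only [Set.mem_Ioi, Set.mem_union, Set.mem_Ioo, Set.mem_Ici]
    constructor
    · intro h
      rcases lt_or_ge t 1 with h1 | h1
      · exact Or.inl ⟨h, h1⟩
      · exact Or.inr h1
    · rintro (h | h) <;> linarith [h]
  rw [hsplit]
  refine ne_top_of_le_ne_top ?_ (lintegral_union_le _ _ _)
  refine ENNReal.add_ne_top.2 ⟨?_, ?_⟩
  · have hle : ∫⁻ t in Set.Ioo (0 : ℝ) 1, layerMajorant ν C p r t ≤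
        ∫⁻ t in Set.Ioo (0 : ℝ) 1, ν Set.univ * ENNReal.ofReal (t ^ (p - 1)) :=
      lintegral_mono fun t => mul_le_mul_left (min_le_left _ _) _
    refine ne_top_of_le_ne_top ?_ hle
    rw [lintegral_const_mul' _ _ (measure_ne_top _ _)]
    refine ENNReal.mul_ne_top (measure_ne_top _ _) ?_
    have hi : IntegrableOn (fun t : ℝ => t ^ (p - 1)) (Set.Ioo 0 1) :=
      (intervalIntegral.integrableOn_Ioo_rpow_iff one_pos).2 (by linarith)
    exact hi.lintegral_lt_top.ne
  · have hle : ∫⁻ t in Set.Ici (1 : ℝ), layerMajorant ν C p r t ≤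
        ∫⁻ t in Set.Ici (1 : ℝ), ENNReal.ofReal (C * t ^ (p - 1 - r)) := by
      refine setLIntegral_mono' measurableSet_Ici fun t ht => ?_
      have ht0 : (0 : ℝ) < t := lt_of_lt_of_le one_pos ht
      refine (mul_le_mul_left (min_le_right _ _) _).trans ?_
      rw [← ENNReal.ofReal_mul (by positivity), mul_assoc, ← Real.rpow_add ht0]
      apply le_of_eq
      congr 3
      ring
    refine ne_top_of_le_ne_top ?_ hle
    have hi : IntegrableOn (fun t : ℝ => C * t ^ (p - 1 - r)) (Set.Ici 1) :=
      ((integrableOn_Ici_iff_integrableOn_Ioi (by simp)).2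
        (integrableOn_Ioi_rpow_of_lt (by linarith) one_pos)).const_mul C
    exact hi.lintegral_lt_top.ne

theorem memLp_of_weakType {f : α → ℂ} (hf : AEStronglyMeasurable f ν) (hC : 0 ≤ C) (hp : 0 ≤ p)
    (hpr : p < r)
    (hw : ∀ t : ℝ, 0 < t → ν {x | t < ‖f x‖} ≤ ENNReal.ofReal (C * t ^ (-r))) :
    MemLp f (ENNReal.ofReal p) ν := by
  rcases hp.eq_or_lt with rfl | hp
  · rw [ENNReal.ofReal_zero]
    exact memLp_zero_iff_aestronglyMeasurable.2 hf
  refine ⟨hf, ?_⟩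
  rw [eLpNorm_lt_top_iff_lintegral_rpow_enorm_lt_top (by simpa using hp) ENNReal.ofReal_ne_top,
    ENNReal.toReal_ofReal hp.le, lintegral_enorm_rpow_eq_lintegral_meas hf hp]
  refine ENNReal.mul_lt_top ENNReal.ofReal_lt_top (lt_of_le_of_lt ?_
    (lintegral_layerMajorant_ne_top (ν := ν) hC hp hpr).lt_top)
  exact setLIntegral_mono' measurableSet_Ioi fun t ht => meas_mul_le_layerMajorant hw ht

theorem tendsto_eLpNorm_of_weakType {f : ℕ → α → ℂ} (hf : ∀ n, AEStronglyMeasurable (f n) ν)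
    (hC : 0 ≤ C) (hp : 0 < p) (hpr : p < r)
    (hw : ∀ n, ∀ t : ℝ, 0 < t → ν {x | t < ‖f n x‖} ≤ ENNReal.ofReal (C * t ^ (-r)))
    (hlim : ∀ t : ℝ, 0 < t → Tendsto (fun n => ν {x | t < ‖f n x‖}) atTop (𝓝 0)) :
    Tendsto (fun n => eLpNorm (f n) (ENNReal.ofReal p) ν) atTop (𝓝 0) := by
  have hint : Tendsto (fun n => ∫⁻ t in Set.Ioi 0,
      ν {x | t < ‖f n x‖} * ENNReal.ofReal (t ^ (p - 1))) atTop (𝓝 0) := by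
    rw [← lintegral_zero (μ := (volume : Measure ℝ).restrict (Set.Ioi 0))]
    refine tendsto_lintegral_of_dominated_convergence (layerMajorant ν C p r) (fun n => ?_)
      (fun n => ?_) (lintegral_layerMajorant_ne_top hC hp hpr) ?_
    · have hanti : Antitone fun t : ℝ => ν {x | t < ‖f n x‖} := fun a b hab =>
        measure_mono fun x hx => lt_of_le_of_lt hab hx
      exact hanti.measurable.mul (by fun_prop)
    · exact (ae_restrict_iff' measurableSet_Ioi).2
        (ae_of_all _ fun t ht => meas_mul_le_layerMajorant (hw n) ht)
    · refine (ae_restrict_iff' measurableSet_Ioi).2 (ae_of_all _ fun t ht => ?_)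
      simpa using ENNReal.Tendsto.mul_const (hlim t ht)
        (Or.inr (ENNReal.ofReal_ne_top (r := t ^ (p - 1))))
  have h2 : Tendsto (fun n => ∫⁻ x, ‖f n x‖ₑ ^ p ∂ν) atTop (𝓝 0) := by
    simp_rw [fun n => lintegral_enorm_rpow_eq_lintegral_meas (hf n) hp]
    simpa using ENNReal.Tendsto.const_mul hint (Or.inr (ENNReal.ofReal_ne_top (r := p)))
  have h3 := (ENNReal.continuous_rpow_const (y := 1 / p)).tendsto 0 |>.comp h2
  rw [ENNReal.zero_rpow_of_pos (by positivity)] at h3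
  refine h3.congr fun n => ?_
  rw [eLpNorm_eq_lintegral_rpow_enorm_toReal (by simpa using hp) ENNReal.ofReal_ne_top,
    ENNReal.toReal_ofReal hp.le]
  rfl

end WeakType

/-! ### Frequency splitting and the weak-type Sobolev bound -/

/-- The part of `f` with frequencies in the ball of radius `A` centred at the origin. -/
noncomputable def lowPart (A : ℝ) (f : L2Plane) : L2Plane :=
  fourierL2.symm (((Lp.memLp (fourierL2 f)).indicator
    (measurableSet_ball (x := (0 : Plane)) (ε := A))).toLp _)

theorem fourierL2_lowPart_ae_eq (A : ℝ) (f : L2Plane) :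
    (fourierL2 (lowPart A f) : Plane → ℂ) =ᵐ[volume]
      (Metric.ball 0 A).indicator (fourierL2 f) := by
  rw [lowPart, LinearIsometryEquiv.apply_symm_apply]
  exact MemLp.coeFn_toLp _

theorem integrable_indicator_ball (A : ℝ) (g : L2Plane) :
    Integrable ((Metric.ball (0 : Plane) A).indicator g) := by
  rw [integrable_indicator_iff measurableSet_ball]
  have : IsFiniteMeasure ((volume : Measure Plane).restrict (Metric.ball 0 A)) :=
    isFiniteMeasure_restrict.2 measure_ball_lt_top.ne
  exact ((Lp.memLp g).restrict _).integrable one_le_two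

theorem lowPart_ae_eq_fourierInv (A : ℝ) (f : L2Plane) :
    (lowPart A f : Plane → ℂ) =ᵐ[volume]
      𝓕⁻ ((Metric.ball (0 : Plane) A).indicator (fourierL2 f)) := by
  have h := fourierL2_lowPart_ae_eq A f
  have h1 := fourierL2_symm_coe_ae_eq_fourierInv (fourierL2 (lowPart A f))
    ((integrable_indicator_ball A (fourierL2 f)).congr h.symm)
  rw [LinearIsometryEquiv.symm_apply_apply] at h1
  filter_upwards [h1] with x hx
  rw [hx]
  exact Real.fourierInv_congr_ae h x

/-- The `L²` norm of `‖ζ‖^{-s}` on the unit ball; the integral converges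
for `s < 1`. -/
noncomputable def bandConst (s : ℝ) : ℝ := √(∫ ζ in Metric.ball (0 : Plane) 1, ‖ζ‖ ^ (-(2 * s)))

theorem bandConst_nonneg (s : ℝ) : 0 ≤ bandConst s := Real.sqrt_nonneg _

theorem setIntegral_ball_norm_rpow (s : ℝ) {A : ℝ} (hA : 0 < A) :
    ∫ ζ in Metric.ball (0 : Plane) A, ‖ζ‖ ^ (-(2 * s)) =
      (A ^ (1 - s) * bandConst s) ^ 2 := by
  have h := Measure.setIntegral_comp_smul_of_pos (volume : Measure Plane)
    (fun ζ : Plane => ‖ζ‖ ^ (-(2 * s))) (Metric.ball 0 1) hA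
  rw [smul_unitBall_of_pos hA] at h
  simp only [norm_smul, Real.norm_of_nonneg hA.le, Real.mul_rpow hA.le (norm_nonneg _),
    integral_const_mul, finrank_euclideanSpace, Fintype.card_fin, smul_eq_mul] at h
  have hI : 0 ≤ ∫ ζ in Metric.ball (0 : Plane) 1, ‖ζ‖ ^ (-(2 * s)) :=
    integral_nonneg fun ζ => by positivity
  rw [mul_pow, bandConst, Real.sq_sqrt hI, ← Real.rpow_natCast (A ^ (1 - s)) 2,
    ← Real.rpow_mul hA.le]
  have hA2 : (A ^ 2)⁻¹ ≠ 0 := by positivity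
  apply mul_left_cancel₀ hA2
  rw [← h, ← mul_assoc]
  congr 1
  rw [← Real.rpow_natCast A 2, ← Real.rpow_neg hA.le, ← Real.rpow_add hA]
  congr 1
  push_cast
  ring

theorem memLp_two_indicator_norm_rpow {s : ℝ} (hs : s < 1) (A : ℝ) :
    MemLp ((Metric.ball (0 : Plane) A).indicator fun ζ => ‖ζ‖ ^ (-s)) 2 := by
  have hmeas : AEStronglyMeasurable ((Metric.ball (0 : Plane) A).indicator fun ζ => ‖ζ‖ ^ (-s)) :=
    (Measurable.indicator (by fun_prop) measurableSet_ball).aestronglyMeasurable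
  rw [memLp_two_iff_integrable_sq hmeas]
  have hint : IntegrableOn (fun ζ : Plane => ‖ζ‖ ^ (-(2 * s))) (Metric.ball 0 A) := by
    refine integrableOn_ball_of_norm_le_rpow (C := 1) (α := 2 * s) (by simp) ?_ ?_ ?_
    · simp only [finrank_euclideanSpace, Fintype.card_fin, Nat.cast_ofNat]
      linarith
    · refine ae_of_all _ fun ζ => ?_
      rw [one_mul, Real.norm_of_nonneg (by positivity)]
    · exact Measurable.aestronglyMeasurable (by fun_prop)
  rw [← integrable_indicator_iff measurableSet_ball] at hint
  refine hint.congr (ae_of_all _ fun ζ => ?_)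
  by_cases hζ : ζ ∈ Metric.ball (0 : Plane) A
  · simp only [Set.indicator_of_mem hζ]
    rw [← Real.rpow_natCast (‖ζ‖ ^ (-s)) 2, ← Real.rpow_mul (norm_nonneg _)]
    congr 1
    push_cast
    ring
  · simp [Set.indicator_of_notMem hζ]

theorem norm_sq_eq_integral_norm_sq (k : L2Plane) : ‖k‖ ^ 2 = ∫ ζ, ‖k ζ‖ ^ 2 := by
  have h : inner ℂ k k = ∫ ζ, inner ℂ (k ζ) (k ζ) := L2.inner_def k k
  simp_rw [inner_self_eq_norm_sq_to_K] at h
  have h1 : ∫ ζ, ((‖k ζ‖ ^ 2 : ℝ) : ℂ) = ((∫ ζ, ‖k ζ‖ ^ 2 : ℝ) : ℂ) := integral_complex_ofReal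
  apply Complex.ofReal_injective
  rw [← h1]
  push_cast
  exact h

/-- Bernstein-type bound: by the Cauchy-Schwarz inequality the part of low frequency is bounded
pointwise by the `L²` norm of `‖ζ‖^{-s}` on the ball of radius `A`, times `‖k‖`. -/
theorem norm_fourierInv_indicator_le {s : ℝ} (hs : s < 1) {A : ℝ} (hA : 0 < A) {f k : L2Plane}
    (hfk : ∀ᵐ ζ, ‖fourierL2 f ζ‖ ≤ ‖ζ‖ ^ (-s) * ‖k ζ‖) (x : Plane) :
    ‖𝓕⁻ ((Metric.ball (0 : Plane) A).indicator (fourierL2 f)) x‖ ≤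
      A ^ (1 - s) * bandConst s * ‖k‖ := by
  set w : Plane → ℝ := (Metric.ball (0 : Plane) A).indicator fun ζ => ‖ζ‖ ^ (-s) with hw
  have hwL : MemLp w 2 := memLp_two_indicator_norm_rpow hs A
  have hkL : MemLp (fun ζ => ‖k ζ‖) 2 := (Lp.memLp k).norm
  have h1 : ‖𝓕⁻ ((Metric.ball (0 : Plane) A).indicator (fourierL2 f)) x‖ ≤
      ∫ ζ, ‖(Metric.ball (0 : Plane) A).indicator (fourierL2 f) ζ‖ :=
    VectorFourier.norm_fourierIntegral_le_integral_norm _ _ (-innerₗ Plane) _ x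
  have h2 : ∫ ζ, ‖(Metric.ball (0 : Plane) A).indicator (fourierL2 f) ζ‖ ≤
      ∫ ζ, ‖w ζ‖ * ‖‖k ζ‖‖ := by
    refine integral_mono_ae (integrable_indicator_ball A _).norm
      (hwL.norm.integrable_mul hkL.norm) ?_
    filter_upwards [hfk] with ζ hζ
    by_cases hm : ζ ∈ Metric.ball (0 : Plane) A
    · simp only [hw, Set.indicator_of_mem hm]
      rw [norm_norm, Real.norm_of_nonneg (by positivity : 0 ≤ ‖ζ‖ ^ (-s))]
      exact hζ
    · simp [hw, Set.indicator_of_notMem hm]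
  have h3 := integral_mul_norm_le_Lp_mul_Lq (μ := (volume : Measure Plane)) (f := w)
    (g := fun ζ => ‖k ζ‖) Real.HolderConjugate.two_two (by simpa using hwL) (by simpa using hkL)
  have hw2 : ∫ ζ, ‖w ζ‖ ^ (2 : ℝ) = (A ^ (1 - s) * bandConst s) ^ 2 := by
    rw [← setIntegral_ball_norm_rpow s hA, ← integral_indicator measurableSet_ball]
    refine integral_congr_ae (ae_of_all _ fun ζ => ?_)
    by_cases hm : ζ ∈ Metric.ball (0 : Plane) A
    · simp only [hw, Set.indicator_of_mem hm]
      rw [Real.norm_of_nonneg (by positivity), ← Real.rpow_mul (norm_nonneg _)]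
      congr 1
      ring
    · simp [hw, Set.indicator_of_notMem hm]
  have hk2 : ∫ ζ, ‖‖k ζ‖‖ ^ (2 : ℝ) = ‖k‖ ^ 2 := by
    rw [norm_sq_eq_integral_norm_sq]
    simp
  rw [hw2, hk2, ← Real.sqrt_eq_rpow, ← Real.sqrt_eq_rpow, Real.sqrt_sq (norm_nonneg _),
    Real.sqrt_sq (mul_nonneg (by positivity) (bandConst_nonneg s))] at h3
  exact h1.trans (h2.trans h3)

theorem norm_sub_lowPart_le {s : ℝ} (hs : 0 ≤ s) {A : ℝ} (hA : 0 < A) {f k : L2Plane}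
    (hfk : ∀ᵐ ζ, ‖fourierL2 f ζ‖ ≤ ‖ζ‖ ^ (-s) * ‖k ζ‖) :
    ‖f - lowPart A f‖ ≤ A ^ (-s) * ‖k‖ := by
  rw [← fourierL2.norm_map, map_sub]
  refine Lp.norm_le_mul_norm_of_ae_le_mul ?_
  filter_upwards [hfk, Lp.coeFn_sub (fourierL2 f) (fourierL2 (lowPart A f)),
    fourierL2_lowPart_ae_eq A f] with ζ h1 h2 h3
  rw [h2, Pi.sub_apply, h3]
  by_cases hm : ζ ∈ Metric.ball (0 : Plane) A
  · rw [Set.indicator_of_mem hm, sub_self, norm_zero]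
    positivity
  · rw [Set.indicator_of_notMem hm, sub_zero]
    rw [mem_ball_zero_iff, not_lt] at hm
    refine h1.trans (mul_le_mul_of_nonneg_right ?_ (norm_nonneg _))
    exact Real.rpow_le_rpow_of_nonpos hA hm (by linarith)

/-- Chebyshev's inequality in `L²`. -/
theorem meas_le_norm_le_of_L2 (g : L2Plane) {t : ℝ} (ht : 0 < t) :
    volume {x | t ≤ ‖g x‖} ≤ ENNReal.ofReal ((‖g‖ / t) ^ 2) := by
  have h := meas_ge_le_mul_pow_eLpNorm_enorm (volume : Measure Plane) (p := 2) (by norm_num)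
    (by norm_num) (Lp.aestronglyMeasurable g) (ε := ENNReal.ofReal t) (by simpa using ht)
    (fun h => absurd h ENNReal.ofReal_ne_top)
  have hset : {x | ENNReal.ofReal t ≤ ‖g x‖ₑ} = {x | t ≤ ‖g x‖} := by
    ext x
    simp only [Set.mem_ofPred_eq]
    rw [← ofReal_norm, ENNReal.ofReal_le_ofReal_iff (norm_nonneg _)]
  rw [hset] at h
  refine h.trans (le_of_eq ?_)
  rw [← ENNReal.ofReal_toReal (Lp.eLpNorm_ne_top g), ← Lp.norm_def, ← ENNReal.ofReal_inv_of_pos ht,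
    ENNReal.toReal_ofNat, ENNReal.ofReal_rpow_of_nonneg (by positivity) (by norm_num),
    ENNReal.ofReal_rpow_of_nonneg (by positivity) (by norm_num), ← ENNReal.ofReal_mul (by positivity)]
  congr 1
  rw [Real.rpow_two, Real.rpow_two]
  field_simp

/-- The weak-type Sobolev inequality: if `|ζ|^s f̂` is bounded in `L²`, then `f` is bounded in weak
`L^r` with `r = 2 / (1 - s)`. -/
theorem exists_weakType_bound {s : ℝ} (hs0 : 0 ≤ s) (hs1 : s < 1) {K : ℝ} (hK : 0 < K) :
    ∃ C : ℝ, 0 ≤ C ∧ ∀ f k : L2Plane, (∀ᵐ ζ, ‖fourierL2 f ζ‖ ≤ ‖ζ‖ ^ (-s) * ‖k ζ‖) → ‖k‖ ≤ K →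
      ∀ t : ℝ, 0 < t → volume {x | t < ‖f x‖} ≤ ENNReal.ofReal (C * t ^ (-(2 / (1 - s)))) := by
  have hs : 0 < 1 - s := by linarith
  have hb : 0 ≤ bandConst s := bandConst_nonneg s
  -- One is added to `bandConst s` so that `B` is visibly positive.
  set B : ℝ := 2 * (bandConst s + 1) * K with hB
  have hBpos : 0 < B := by positivity
  refine ⟨4 * K ^ 2 * B ^ (2 * s / (1 - s)), by positivity, fun f k hfk hk t ht => ?_⟩
  -- This cutoff makes the part of low frequency at most `t / 2`.
  set A : ℝ := (t / B) ^ (1 / (1 - s)) with hAdef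
  have hA : 0 < A := by positivity
  have hA1 : A ^ (1 - s) = t / B := by
    rw [hAdef, ← Real.rpow_mul (by positivity), one_div_mul_cancel hs.ne', Real.rpow_one]
  have hlow : A ^ (1 - s) * bandConst s * ‖k‖ ≤ t / 2 := by
    have h1 : bandConst s * ‖k‖ ≤ B / 2 := by
      rw [hB]
      nlinarith [norm_nonneg k]
    calc A ^ (1 - s) * bandConst s * ‖k‖ = t / B * (bandConst s * ‖k‖) := by rw [hA1]; ring
      _ ≤ t / B * (B / 2) := by gcongr
      _ = t / 2 := by field_simp
  have hsub : volume {x | t < ‖f x‖} ≤ volume {x | t / 2 ≤ ‖(f - lowPart A f : L2Plane) x‖} := by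
    refine measure_mono_ae ?_
    filter_upwards [lowPart_ae_eq_fourierInv A f, Lp.coeFn_sub f (lowPart A f)] with x h1 h2 h3
    change t < ‖f x‖ at h3
    change t / 2 ≤ ‖(f - lowPart A f : L2Plane) x‖
    have h4 := (norm_fourierInv_indicator_le hs1 hA hfk x).trans hlow
    rw [← h1] at h4
    rw [h2, Pi.sub_apply]
    linarith [norm_sub_norm_le (f x) (lowPart A f x)]
  refine hsub.trans ((meas_le_norm_le_of_L2 _ (half_pos ht)).trans (ENNReal.ofReal_le_ofReal ?_))
  have hhigh : ‖f - lowPart A f‖ ≤ A ^ (-s) * K :=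
    (norm_sub_lowPart_le hs0 hA hfk).trans (by gcongr)
  calc (‖f - lowPart A f‖ / (t / 2)) ^ 2 ≤ (A ^ (-s) * K / (t / 2)) ^ 2 := by gcongr
    _ = 4 * K ^ 2 * ((A ^ (-s)) ^ 2 * (t ^ 2)⁻¹) := by field_simp; ring
    _ = 4 * K ^ 2 * (B ^ (2 * s / (1 - s)) * t ^ (-(2 / (1 - s)))) := by
      congr 1
      have e1 : (A ^ (-s)) ^ 2 = B ^ (2 * s / (1 - s)) * t ^ (-(2 * s / (1 - s))) := by
        rw [← Real.rpow_natCast, ← Real.rpow_mul hA.le, hAdef, ← Real.rpow_mul (by positivity),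
          Real.div_rpow ht.le hBpos.le, div_eq_mul_inv, ← Real.rpow_neg hBpos.le, mul_comm]
        congr 2 <;> push_cast <;> field_simp
      have e2 : (t ^ 2)⁻¹ = t ^ (-2 : ℝ) := by
        rw [Real.rpow_neg ht.le, Real.rpow_two]
      rw [e1, e2, mul_assoc, ← Real.rpow_add ht]
      congr 2
      field_simp
      ring
    _ = _ := by ring

/-! ### Local compactness of Bessel potentials -/

section Compactness

variable {s : ℝ} {j : Plane → ℂ} {f k : ℕ → L2Plane}

/-- At each point the part of low frequency is the inner product of `k n` with a fixed element of `L²`,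
so it tends to zero when `k n` does so weakly. -/
theorem tendsto_fourierInv_indicator (hs : s < 1) (hj : Measurable j)
    (hjs : ∀ᵐ ζ, ‖j ζ‖ ≤ ‖ζ‖ ^ (-s))
    (hfk : ∀ n, (fourierL2 (f n) : Plane → ℂ) =ᵐ[volume] fun ζ => j ζ * k n ζ)
    (hk : ∀ h : L2Plane, Tendsto (fun n => inner ℂ h (k n)) atTop (𝓝 0)) (A : ℝ) (x : Plane) :
    Tendsto (fun n => 𝓕⁻ ((Metric.ball (0 : Plane) A).indicator (fourierL2 (f n))) x)
      atTop (𝓝 0) := by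
  set h : Plane → ℂ := (Metric.ball (0 : Plane) A).indicator fun ζ =>
    (starRingEnd ℂ) ((Real.fourierChar (inner ℝ ζ x) : ℂ) * j ζ) with hh
  have hmeas : Measurable h := by
    refine Measurable.indicator ?_ measurableSet_ball
    have hc : Continuous fun ζ : Plane => (Real.fourierChar (inner ℝ ζ x) : ℂ) :=
      continuous_subtype_val.comp (Real.continuous_fourierChar.comp (by fun_prop))
    exact Complex.continuous_conj.measurable.comp (hc.measurable.mul hj)
  have hL : MemLp h 2 := by
    refine (memLp_two_indicator_norm_rpow hs A).of_le hmeas.aestronglyMeasurable ?_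
    filter_upwards [hjs] with ζ hζ
    by_cases hm : ζ ∈ Metric.ball (0 : Plane) A
    · simp only [hh, Set.indicator_of_mem hm]
      rw [RCLike.norm_conj, norm_mul, Circle.norm_coe, one_mul,
        Real.norm_of_nonneg (by positivity)]
      exact hζ
    · simp [hh, Set.indicator_of_notMem hm]
  refine (hk (hL.toLp h)).congr fun n => ?_
  rw [L2.inner_def, Real.fourierInv_eq]
  refine integral_congr_ae ?_
  filter_upwards [hL.coeFn_toLp, hfk n] with ζ h1 h2
  rw [h1]
  by_cases hm : ζ ∈ Metric.ball (0 : Plane) A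
  · simp only [hh, Set.indicator_of_mem hm]
    rw [h2, RCLike.inner_apply, RCLike.conj_conj, Circle.smul_def, smul_eq_mul]
    ring
  · simp [hh, Set.indicator_of_notMem hm]

/-- If `k n` is bounded and tends weakly to zero, then the functions with Fourier transforms `j * k n`
tend to zero in measure on balls, for any symbol `j` dominated by `‖ζ‖^{-s}`. -/
theorem tendsto_meas_of_weakly_tendsto_zero (hs0 : 0 < s) (hs1 : s < 1) (hj : Measurable j)
    (hjs : ∀ᵐ ζ, ‖j ζ‖ ≤ ‖ζ‖ ^ (-s))
    (hfk : ∀ n, (fourierL2 (f n) : Plane → ℂ) =ᵐ[volume] fun ζ => j ζ * k n ζ)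
    {K : ℝ} (hkK : ∀ n, ‖k n‖ ≤ K)
    (hk : ∀ h : L2Plane, Tendsto (fun n => inner ℂ h (k n)) atTop (𝓝 0)) (R : ℝ) {t : ℝ}
    (ht : 0 < t) :
    Tendsto (fun n => (volume.restrict (Metric.ball (0 : Plane) R)) {x | t < ‖f n x‖})
      atTop (𝓝 0) := by
  set ν := (volume : Measure Plane).restrict (Metric.ball 0 R)
  have : IsFiniteMeasure ν := isFiniteMeasure_restrict.2 measure_ball_lt_top.ne
  have hνle : ν ≤ volume := Measure.restrict_le_self
  have hbound : ∀ n, ∀ᵐ ζ, ‖fourierL2 (f n) ζ‖ ≤ ‖ζ‖ ^ (-s) * ‖k n ζ‖ := fun n => by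
    filter_upwards [hfk n, hjs] with ζ h1 h2
    rw [h1, norm_mul]
    gcongr
  rw [ENNReal.tendsto_nhds_zero]
  intro ε hε
  -- At a high enough cutoff the part of high frequency contributes at most `ε / 2`, uniformly in `n`.
  obtain ⟨A, hA, hAε⟩ : ∃ A : ℝ, 0 < A ∧
      ENNReal.ofReal ((A ^ (-s) * K / (t / 2)) ^ 2) ≤ ε / 2 := by
    have h1 : Tendsto (fun A : ℝ => ENNReal.ofReal ((A ^ (-s) * K / (t / 2)) ^ 2)) atTop
        (𝓝 (ENNReal.ofReal ((0 * K / (t / 2)) ^ 2))) :=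
      ENNReal.tendsto_ofReal ((((tendsto_rpow_neg_atTop hs0).mul_const K).div_const _).pow 2)
    rw [zero_mul, zero_div, zero_pow two_ne_zero, ENNReal.ofReal_zero] at h1
    obtain ⟨A, h2, h3⟩ := ((eventually_gt_atTop 0).and
      ((ENNReal.tendsto_nhds_zero.1 h1) (ε / 2) (ENNReal.half_pos hε.ne'))).exists
    exact ⟨A, h2, h3⟩
  have hlow : TendstoInMeasure ν (fun n => (lowPart A (f n) : Plane → ℂ)) atTop fun _ => 0 := by
    refine tendstoInMeasure_of_tendsto_ae
      (fun n => (Lp.aestronglyMeasurable _).mono_measure hνle) ?_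
    refine ae_mono hνle ?_
    filter_upwards [ae_all_iff.2 fun n => lowPart_ae_eq_fourierInv A (f n)] with x hx
    simp_rw [hx]
    exact tendsto_fourierInv_indicator hs1 hj hjs hfk hk A x
  rw [tendstoInMeasure_iff_norm] at hlow
  filter_upwards [ENNReal.tendsto_nhds_zero.1 (hlow (t / 2) (half_pos ht)) (ε / 2)
    (ENNReal.half_pos hε.ne')] with n hn
  have hhigh : ν {x | t / 2 ≤ ‖(f n - lowPart A (f n) : L2Plane) x‖} ≤ ε / 2 := by
    refine (hνle _).trans ((meas_le_norm_le_of_L2 _ (half_pos ht)).trans (le_trans ?_ hAε))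
    refine ENNReal.ofReal_le_ofReal ?_
    have := (norm_sub_lowPart_le hs0.le hA (hbound n)).trans
      (mul_le_mul_of_nonneg_left (hkK n) (by positivity))
    gcongr
  have hsub : ν {x | t < ‖f n x‖} ≤ ν ({x | t / 2 ≤ ‖lowPart A (f n) x - 0‖} ∪
      {x | t / 2 ≤ ‖(f n - lowPart A (f n) : L2Plane) x‖}) := by
    refine measure_mono_ae (ae_mono hνle ?_)
    filter_upwards [Lp.coeFn_sub (f n) (lowPart A (f n))] with x h1 h2
    change t < ‖f n x‖ at h2
    by_contra hcon
    have h3 := not_or.1 hcon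
    have h4 : ‖lowPart A (f n) x - 0‖ < t / 2 := not_le.1 h3.1
    have h5 : ‖(f n - lowPart A (f n) : L2Plane) x‖ < t / 2 := not_le.1 h3.2
    rw [h1, Pi.sub_apply] at h5
    rw [sub_zero] at h4
    linarith [norm_sub_norm_le (f n x) (lowPart A (f n) x)]
  calc ν {x | t < ‖f n x‖} ≤ _ := hsub
    _ ≤ _ := measure_union_le _ _
    _ ≤ ε / 2 + ε / 2 := add_le_add hn hhigh
    _ = ε := ENNReal.add_halves ε

end Compactness

/-- The symbol `(1 + ‖ζ‖)^{-s}`; multiplying `L²` by it gives the Fourier transforms of the elements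
of the Sobolev space `H^s`. -/
noncomputable def besselSymbol (s : ℝ) (ζ : Plane) : ℂ := (((1 + ‖ζ‖) ^ (-s) : ℝ) : ℂ)

theorem measurable_besselSymbol (s : ℝ) : Measurable (besselSymbol s) := by
  unfold besselSymbol
  fun_prop

theorem norm_besselSymbol (s : ℝ) (ζ : Plane) : ‖besselSymbol s ζ‖ = (1 + ‖ζ‖) ^ (-s) := by
  rw [besselSymbol, Complex.norm_real, Real.norm_of_nonneg (by positivity)]

theorem ae_norm_besselSymbol_le {s : ℝ} (hs : 0 ≤ s) :
    ∀ᵐ ζ : Plane, ‖besselSymbol s ζ‖ ≤ ‖ζ‖ ^ (-s) := by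
  have h0 : ∀ᵐ ζ : Plane, ζ ≠ 0 := by simp [ae_iff]
  filter_upwards [h0] with ζ hζ
  rw [norm_besselSymbol]
  exact Real.rpow_le_rpow_of_nonpos (norm_pos_iff.2 hζ) (by linarith) (by linarith)

theorem memLp_besselSymbol_mul {s : ℝ} (hs : 0 ≤ s) (k : L2Plane) :
    MemLp (fun ζ => besselSymbol s ζ * k ζ) 2 volume := by
  refine (Lp.memLp k).of_le
    ((measurable_besselSymbol s).aestronglyMeasurable.mul (Lp.aestronglyMeasurable k))
    (ae_of_all _ fun ζ => ?_)
  rw [norm_mul, norm_besselSymbol]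
  exact mul_le_of_le_one_left (norm_nonneg _)
    (Real.rpow_le_one_of_one_le_of_nonpos (by linarith [norm_nonneg ζ]) (by linarith))

/-- The Sobolev embedding of `H^s(ℝ²)` in `L^p_loc`, `p < 2 / (1 - s)`. -/
theorem memLp_ball_of_bessel {s : ℝ} (hs0 : 0 ≤ s) (hs1 : s < 1) {f k : L2Plane}
    (hfk : (fourierL2 f : Plane → ℂ) =ᵐ[volume] fun ζ => besselSymbol s ζ * k ζ)
    {p : ℝ} (hp : 0 ≤ p) (hps : p < 2 / (1 - s)) (R : ℝ) :
    MemLp f (ENNReal.ofReal p) (volume.restrict (Metric.ball 0 R)) := by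
  obtain ⟨C, hC, hw⟩ := exists_weakType_bound hs0 hs1 (K := ‖k‖ + 1) (by positivity)
  have hνle : (volume : Measure Plane).restrict (Metric.ball 0 R) ≤ volume :=
    Measure.restrict_le_self
  have : IsFiniteMeasure ((volume : Measure Plane).restrict (Metric.ball 0 R)) :=
    isFiniteMeasure_restrict.2 measure_ball_lt_top.ne
  refine memLp_of_weakType ((Lp.aestronglyMeasurable f).mono_measure hνle) hC hp hps
    fun t ht => (hνle _).trans (hw f k ?_ (by linarith) t ht)
  filter_upwards [hfk, ae_norm_besselSymbol_le hs0] with ζ h1 h2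
  rw [h1, norm_mul]
  gcongr

/-- The Rellich-Kondrachov theorem for `H^s(ℝ²)`: bounded sequences have subsequences converging in
`L^p_loc`, `p < 2 / (1 - s)`. The limit and the subsequence do not depend on the ball. -/
theorem exists_subseq_tendsto_of_bessel {s : ℝ} (hs0 : 0 < s) (hs1 : s < 1) {f k : ℕ → L2Plane}
    (hfk : ∀ n, (fourierL2 (f n) : Plane → ℂ) =ᵐ[volume] fun ζ => besselSymbol s ζ * k n ζ)
    {K : ℝ} (hkK : ∀ n, ‖k n‖ ≤ K) {p : ℝ} (hp : 0 ≤ p) (hps : p < 2 / (1 - s)) :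
    ∃ φ : ℕ → ℕ, StrictMono φ ∧ ∃ v : L2Plane, ∀ R : ℝ,
      MemLp v (ENNReal.ofReal p) (volume.restrict (Metric.ball 0 R)) ∧
      TendstoLp p (volume.restrict (Metric.ball 0 R)) (fun n => (f (φ n) : Plane → ℂ)) v := by
  have : Fact ((2 : ℝ≥0∞) ≠ ∞) := ⟨ENNReal.ofNat_ne_top⟩
  have : SecondCountableTopology L2Plane := Lp.SecondCountableTopology
  obtain ⟨φ, hφ, a, ha⟩ := exists_subseq_weakly_tendsto hkK
  set v : L2Plane := fourierL2.symm ((memLp_besselSymbol_mul hs0.le a).toLp _)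
  have hv : (fourierL2 v : Plane → ℂ) =ᵐ[volume] fun ζ => besselSymbol s ζ * a ζ := by
    rw [LinearIsometryEquiv.apply_symm_apply]
    exact MemLp.coeFn_toLp _
  have hd : ∀ n, (fourierL2 (f (φ n) - v) : Plane → ℂ) =ᵐ[volume]
      fun ζ => besselSymbol s ζ * (k (φ n) - a : L2Plane) ζ := fun n => by
    rw [map_sub]
    filter_upwards [Lp.coeFn_sub (fourierL2 (f (φ n))) (fourierL2 v), hv, hfk (φ n),
      Lp.coeFn_sub (k (φ n)) a] with ζ h1 h2 h3 h4
    rw [h1, Pi.sub_apply, h2, h3, h4, Pi.sub_apply, mul_sub]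
  have hdK : ∀ n, ‖k (φ n) - a‖ ≤ K + ‖a‖ := fun n =>
    (norm_sub_le _ _).trans (by linarith [hkK (φ n)])
  have hK : 0 ≤ K := (norm_nonneg _).trans (hkK 0)
  have hweak : ∀ h : L2Plane, Tendsto (fun n => inner ℂ h (k (φ n) - a)) atTop (𝓝 0) := fun h => by
    have h1 := (Complex.continuous_conj.tendsto _).comp (ha h)
    have h2 := h1.sub_const (inner ℂ h a)
    simp only [inner_conj_symm, sub_self] at h2
    refine h2.congr fun n => ?_
    simp only [Function.comp_apply, inner_conj_symm, inner_sub_right]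
  obtain ⟨C, hC, hw⟩ := exists_weakType_bound hs0.le hs1 (K := K + ‖a‖ + 1) (by positivity)
  have hbound : ∀ n, ∀ᵐ ζ, ‖fourierL2 (f (φ n) - v) ζ‖ ≤
      ‖ζ‖ ^ (-s) * ‖(k (φ n) - a : L2Plane) ζ‖ := fun n => by
    filter_upwards [hd n, ae_norm_besselSymbol_le hs0.le] with ζ h1 h2
    rw [h1, norm_mul]
    gcongr
  refine ⟨φ, hφ, v, fun R => ⟨memLp_ball_of_bessel hs0.le hs1 hv hp hps R, ?_⟩⟩
  have hνle : (volume : Measure Plane).restrict (Metric.ball 0 R) ≤ volume :=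
    Measure.restrict_le_self
  have : IsFiniteMeasure ((volume : Measure Plane).restrict (Metric.ball 0 R)) :=
    isFiniteMeasure_restrict.2 measure_ball_lt_top.ne
  have hLq : ∀ q : ℝ, 0 < q → q < 2 / (1 - s) → Tendsto (fun n =>
      eLpNorm ((f (φ n) : Plane → ℂ) - (v : Plane → ℂ)) (ENNReal.ofReal q)
        (volume.restrict (Metric.ball 0 R)))
      atTop (𝓝 0) := fun q hq hqs => by
    refine (tendsto_eLpNorm_of_weakType (f := fun n => (f (φ n) - v : L2Plane))
      (fun n => (Lp.aestronglyMeasurable _).mono_measure hνle) hC hq hqs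
      (fun n t ht => (hνle _).trans
        (hw _ _ (hbound n) ((hdK n).trans (by linarith)) t ht))
      (fun t ht => tendsto_meas_of_weakly_tendsto_zero hs0 hs1 (measurable_besselSymbol s)
        (ae_norm_besselSymbol_le hs0.le) hd hdK hweak R ht)).congr fun n => ?_
    exact eLpNorm_congr_ae (ae_mono hνle (Lp.coeFn_sub _ _))
  rw [TendstoLp]
  split_ifs with h0
  -- Convergence in measure follows from convergence in `L^q` for any positive admissible `q`.
  · refine tendstoInMeasure_of_tendsto_eLpNorm (p := ENNReal.ofReal (1 / (1 - s))) ?_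
      (fun n => (Lp.aestronglyMeasurable _).mono_measure hνle)
      ((Lp.aestronglyMeasurable _).mono_measure hνle) (hLq _ ?_ ?_)
    · simpa using hs1
    · exact one_div_pos.2 (by linarith)
    · exact div_lt_div_of_pos_right one_lt_two (by linarith)
  · exact hLq p (lt_of_le_of_ne hp (Ne.symm h0)) hps

/-! ### Comparison of the symbols of `X^{1/2}` with an isotropic weight -/

theorem norm_le_abs_add_abs (ζ : Plane) : ‖ζ‖ ≤ |ζ 0| + |ζ 1| := by
  rw [EuclideanSpace.norm_eq, Fin.sum_univ_two, Real.norm_eq_abs, Real.norm_eq_abs]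
  refine Real.sqrt_le_iff.2 ⟨by positivity, ?_⟩
  nlinarith [abs_nonneg (ζ 0), abs_nonneg (ζ 1)]

theorem ae_apply_zero_ne_zero : ∀ᵐ ζ : Plane, ζ 0 ≠ 0 := by
  have h : volume ((LinearMap.ker (EuclideanSpace.proj (𝕜 := ℝ) (0 : Fin 2) :
      Plane →L[ℝ] ℝ).toLinearMap : Submodule ℝ Plane) : Set Plane) = 0 := by
    refine Measure.addHaar_submodule _ _ fun htop => ?_
    have h1 : (EuclideanSpace.single (0 : Fin 2) (1 : ℝ) : Plane) ∈
        LinearMap.ker (EuclideanSpace.proj (𝕜 := ℝ) (0 : Fin 2) : Plane →L[ℝ] ℝ).toLinearMap := by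
      rw [htop]
      trivial
    simp at h1
  rw [ae_iff]
  convert h using 2
  ext ζ
  simp

/-- With `q = b / √a` one has `b = √a q`, so that `1`, `a` and `b` are all bounded by
`(1 + √a + q)²`. -/
theorem one_add_add_rpow_half_le {a b : ℝ} (ha : 0 < a) (hb : 0 ≤ b) :
    (1 + (a + b)) ^ (1 / 2 : ℝ) ≤ 3 * (1 + √a + b / √a) := by
  have hs : 0 < √a := Real.sqrt_pos.2 ha
  have hsq : √a * √a = a := Real.mul_self_sqrt ha.le
  set q := b / √a with hq
  have hq0 : 0 ≤ q := by positivity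
  have hbq : b = √a * q := by rw [hq]; field_simp
  rw [← Real.sqrt_eq_rpow]
  refine Real.sqrt_le_iff.2 ⟨by positivity, ?_⟩
  nlinarith [mul_nonneg hs.le hq0]

/-- With `q = b / a` one has `b = √a² q`, so that `1`, `a` and `b` are all bounded by
`(1 + √a + q)³`. -/
theorem one_add_add_rpow_third_le {a b : ℝ} (ha : 0 < a) (hb : 0 ≤ b) :
    (1 + (a + b)) ^ (1 / 3 : ℝ) ≤ 3 * (1 + √a + b / a) := by
  have hs : 0 < √a := Real.sqrt_pos.2 ha
  have hsq : √a * √a = a := Real.mul_self_sqrt ha.le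
  set q := b / a with hq
  have hq0 : 0 ≤ q := by positivity
  have hbq : b = √a * √a * q := by rw [hsq, hq]; field_simp
  have hle : 1 + (a + b) ≤ (3 * (1 + √a + q)) ^ (3 : ℝ) := by
    rw [Real.rpow_ofNat, hbq]
    nth_rewrite 1 [← hsq]
    have hexp : (3 * (1 + √a + q)) ^ 3 - (1 + (√a * √a + √a * √a * q)) = 26 + 80 * √a ^ 2 +
        80 * √a ^ 2 * q + 27 * (√a ^ 3 + q ^ 3 + 3 * √a + 3 * q + 6 * √a * q + 3 * q ^ 2 +
        3 * √a * q ^ 2) := by ring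
    have : 0 ≤ (3 * (1 + √a + q)) ^ 3 - (1 + (√a * √a + √a * √a * q)) := by
      rw [hexp]
      positivity
    linarith
  calc (1 + (a + b)) ^ (1 / 3 : ℝ) ≤ ((3 * (1 + √a + q)) ^ (3 : ℝ)) ^ (1 / 3 : ℝ) := by gcongr
    _ = 3 * (1 + √a + q) := by
      rw [← Real.rpow_mul (by positivity)]
      norm_num

theorem sqrt_le_norm_symbolDx_half (ζ : Plane) : √|ζ 0| ≤ ‖symbolDx (1 / 2) ζ‖ := by
  rw [symbolDx, Complex.norm_real, Real.norm_of_nonneg (by positivity), Real.sqrt_eq_rpow]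
  have h : |ζ 0| ≤ 2 * Real.pi * |ζ 0| := by
    nlinarith [Real.pi_gt_three, abs_nonneg (ζ 0)]
  gcongr

theorem mul_div_sqrt_le_norm_symbol {c : ℝ} (hc : 0 ≤ c) {ζ : Plane} (hζ : ζ 0 ≠ 0) :
    c * (|ζ 1| / √|ζ 0|) ≤ ‖(c : ℂ) * (symbolDx (-1 / 2) ζ * symbolPy ζ)‖ := by
  have ha : 0 < |ζ 0| := abs_pos.2 hζ
  have hpi := Real.pi_gt_three
  have h2 : ‖symbolPy ζ‖ = 2 * Real.pi * |ζ 1| := by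
    simp [symbolPy, abs_of_pos Real.pi_pos]
  have h3 : ‖symbolDx (-1 / 2) ζ‖ = (√(2 * Real.pi) * √|ζ 0|)⁻¹ := by
    rw [symbolDx, Complex.norm_real, Real.norm_of_nonneg (by positivity), neg_div,
      Real.rpow_neg (by positivity), ← Real.sqrt_eq_rpow, Real.sqrt_mul (by positivity)]
  rw [norm_mul, norm_mul, h2, h3, Complex.norm_real, Real.norm_of_nonneg hc]
  refine mul_le_mul_of_nonneg_left ?_ hc
  have h4 : (√(2 * Real.pi) * √|ζ 0|)⁻¹ * (2 * Real.pi * |ζ 1|) =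
      √(2 * Real.pi) * (|ζ 1| / √|ζ 0|) := by
    rw [mul_inv, ← Real.mul_self_sqrt (show 0 ≤ 2 * Real.pi by positivity),
      Real.sqrt_mul_self (Real.sqrt_nonneg _)]
    have hp : √(2 * Real.pi) ≠ 0 := (Real.sqrt_pos.2 (by positivity)).ne'
    field_simp
  rw [h4]
  refine le_mul_of_one_le_left (by positivity) ?_
  exact Real.one_le_sqrt.2 (by linarith)

theorem norm_symbolPxInvPy {c : ℝ} (hc : 0 ≤ c) (ζ : Plane) :
    ‖(c : ℂ) * ((symbolPx ζ)⁻¹ * symbolPy ζ)‖ = c * (|ζ 1| / |ζ 0|) := by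
  have hpi := Real.pi_pos
  simp only [symbolPx, symbolPy, norm_mul, norm_inv, Complex.norm_real, Complex.norm_I,
    Real.norm_of_nonneg hc, Complex.norm_ofNat, Real.norm_of_nonneg hpi.le, Real.norm_eq_abs,
    mul_one]
  rw [mul_inv, div_eq_mul_inv]
  field_simp

theorem norm_components_apply_le {lam mu : ℝ} (f : XHalf lam mu) (i : Fin 4) :
    ‖XHalf.components lam mu f i‖ ≤ ‖f‖ :=
  PiLp.norm_apply_le (XHalf.components lam mu f) i

/-- If the symbols of the norm of `X^{1/2}` control `(1 + ‖ζ‖)^s`, then `X^{1/2}` embeds in `H^s`. -/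
theorem XHalf.exists_eq_bessel {lam mu s D : ℝ} (hD : 0 ≤ D)
    (hw : ∀ᵐ ζ : Plane, (1 + ‖ζ‖) ^ s ≤ D * (1 + ‖symbolDx (1 / 2) ζ‖ +
      ‖((√lam : ℝ) : ℂ) * (symbolDx (-1 / 2) ζ * symbolPy ζ)‖ +
      ‖((√mu : ℝ) : ℂ) * ((symbolPx ζ)⁻¹ * symbolPy ζ)‖)) (f : XHalf lam mu) :
    ∃ k : L2Plane, (fourierL2 f.toL2 : Plane → ℂ) =ᵐ[volume] (fun ζ => besselSymbol s ζ * k ζ) ∧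
      ‖k‖ ≤ 4 * D * ‖f‖ := by
  set m1 : Plane → ℂ := symbolDx (1 / 2)
  set m2 : Plane → ℂ := fun ζ => ((√lam : ℝ) : ℂ) * (symbolDx (-1 / 2) ζ * symbolPy ζ)
  set m3 : Plane → ℂ := fun ζ => ((√mu : ℝ) : ℂ) * ((symbolPx ζ)⁻¹ * symbolPy ζ)
  set F : L2Plane := fourierL2 f.toL2
  have H1 : MemLp (fun ζ => m1 ζ * F ζ) 2 volume := mem_fourierMultiplier_domain.1 f.2.1.1
  have H2 : MemLp (fun ζ => m2 ζ * F ζ) 2 volume := mem_fourierMultiplier_domain.1 f.2.1.2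
  have H3 : MemLp (fun ζ => m3 ζ * F ζ) 2 volume := mem_fourierMultiplier_domain.1 f.2.2
  have N0 : eLpNorm F 2 volume ≤ ENNReal.ofReal ‖f‖ := by
    have h := norm_components_apply_le f 0
    have e : ‖XHalf.components lam mu f 0‖ = ‖F‖ := (fourierL2.norm_map f.toL2).symm
    rw [e, Lp.norm_def] at h
    exact (ENNReal.le_ofReal_iff_toReal_le (Lp.eLpNorm_ne_top F) (norm_nonneg _)).2 h
  have key : ∀ (m : Plane → ℂ) (g : (fourierMultiplier m).domain),
      ‖fourierMultiplier m g‖ ≤ ‖f‖ →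
      eLpNorm (fun ζ => m ζ * fourierL2 g.1 ζ) 2 volume ≤ ENNReal.ofReal ‖f‖ := fun m g h => by
    rw [← fourierL2.norm_map, fourierL2_fourierMultiplier, Lp.norm_toLp] at h
    exact (ENNReal.le_ofReal_iff_toReal_le
      (mem_fourierMultiplier_domain.1 g.2).eLpNorm_ne_top (norm_nonneg _)).2 h
  have N1 : eLpNorm (fun ζ => m1 ζ * F ζ) 2 volume ≤ ENNReal.ofReal ‖f‖ :=
    key m1 ⟨f.1, f.2.1.1⟩ (norm_components_apply_le f 1)
  have N2 : eLpNorm (fun ζ => m2 ζ * F ζ) 2 volume ≤ ENNReal.ofReal ‖f‖ :=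
    key m2 ⟨f.1, f.2.1.2⟩ (norm_components_apply_le f 2)
  have N3 : eLpNorm (fun ζ => m3 ζ * F ζ) 2 volume ≤ ENNReal.ofReal ‖f‖ :=
    key m3 ⟨f.1, f.2.2⟩ (norm_components_apply_le f 3)
  set G : Plane → ℝ := (fun ζ => ‖F ζ‖) + (fun ζ => ‖m1 ζ * F ζ‖) + (fun ζ => ‖m2 ζ * F ζ‖) +
    (fun ζ => ‖m3 ζ * F ζ‖) with hG
  have M0 := (Lp.memLp F).norm
  have NG : eLpNorm G 2 volume ≤ ENNReal.ofReal (4 * ‖f‖) := by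
    have h1 := eLpNorm_add_le M0.1 H1.norm.1 one_le_two
    have h2 := eLpNorm_add_le (M0.add H1.norm).1 H2.norm.1 one_le_two
    have h3 := eLpNorm_add_le ((M0.add H1.norm).add H2.norm).1 H3.norm.1 one_le_two
    rw [eLpNorm_norm] at h1 h2 h3
    rw [eLpNorm_norm] at h1
    have e : ENNReal.ofReal (4 * ‖f‖) = ENNReal.ofReal ‖f‖ + ENNReal.ofReal ‖f‖ +
        ENNReal.ofReal ‖f‖ + ENNReal.ofReal ‖f‖ := by
      rw [← ENNReal.ofReal_add (by positivity) (by positivity),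
        ← ENNReal.ofReal_add (by positivity) (by positivity),
        ← ENNReal.ofReal_add (by positivity) (by positivity)]
      congr 1
      ring
    rw [e]
    refine h3.trans (add_le_add (h2.trans (add_le_add (h1.trans (add_le_add N0 N1)) N2)) N3)
  have MG : MemLp G 2 volume := ((M0.add H1.norm).add H2.norm).add H3.norm
  have hcont : AEStronglyMeasurable (fun ζ : Plane => (((1 + ‖ζ‖) ^ s : ℝ) : ℂ) * F ζ) volume :=
    (Measurable.aestronglyMeasurable (by fun_prop)).mul (Lp.aestronglyMeasurable F)
  have hle : ∀ᵐ ζ : Plane, ‖(((1 + ‖ζ‖) ^ s : ℝ) : ℂ) * F ζ‖ ≤ D * ‖G ζ‖ := by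
    filter_upwards [hw] with ζ hζ
    have hG0 : ‖G ζ‖ = G ζ := Real.norm_of_nonneg (by simp only [hG, Pi.add_apply]; positivity)
    rw [hG0, norm_mul, Complex.norm_real, Real.norm_of_nonneg (by positivity)]
    refine (mul_le_mul_of_nonneg_right hζ (norm_nonneg _)).trans (le_of_eq ?_)
    simp only [hG, Pi.add_apply, norm_mul, m1, m2, m3]
    ring
  have hk : MemLp (fun ζ : Plane => (((1 + ‖ζ‖) ^ s : ℝ) : ℂ) * F ζ) 2 volume :=
    MG.of_le_mul hcont hle
  refine ⟨hk.toLp _, ?_, ?_⟩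
  · filter_upwards [hk.coeFn_toLp] with ζ h1
    rw [h1, besselSymbol, ← mul_assoc, ← Complex.ofReal_mul, ← Real.rpow_add (by positivity)]
    simp
  · rw [Lp.norm_toLp]
    refine ENNReal.toReal_le_of_le_ofReal (by positivity) ?_
    refine (eLpNorm_le_mul_eLpNorm_of_ae_le_mul hle 2).trans ?_
    rw [show 4 * D * ‖f‖ = D * (4 * ‖f‖) by ring, ENNReal.ofReal_mul hD]
    exact mul_le_mul_right NG _

/-- The symbols of the norm of `X^{1/2}` control `(1 + ‖ζ‖)^s` with `s = 1/2` if `λ > 0`, and with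
`s = 1/3` if `λ = 0`. On the null set `ξ = 0` the negative powers of `ξ` have the value zero, and the
bound fails there for large `η`. -/
theorem exists_weight_bound {lam mu : ℝ} (hlam : 0 ≤ lam) (hmu : 0 ≤ mu)
    (hne : ¬ (lam = 0 ∧ mu = 0)) :
    ∃ D : ℝ, 0 ≤ D ∧ ∀ᵐ ζ : Plane, (1 + ‖ζ‖) ^ (if 0 < lam then 1 / 2 else 1 / 3 : ℝ) ≤
      D * (1 + ‖symbolDx (1 / 2) ζ‖ +
        ‖((√lam : ℝ) : ℂ) * (symbolDx (-1 / 2) ζ * symbolPy ζ)‖ +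
        ‖((√mu : ℝ) : ℂ) * ((symbolPx ζ)⁻¹ * symbolPy ζ)‖) := by
  -- it suffices to control `1 + √|ξ| + q` with `q` comparable to one of the last two symbols
  have combine : ∀ {c q A B W M : ℝ}, 0 < c → 0 ≤ W → 0 ≤ M → 0 ≤ A → A ≤ B → c * q ≤ W →
      3 * (1 + A + q) ≤ 3 * (1 + c⁻¹) * (1 + B + W + M) := by
    intro c q A B W M hc hW hM hA hAB hq
    have h1 : q ≤ c⁻¹ * W := by
      rw [inv_mul_eq_div, le_div_iff₀ hc]
      linarith
    have hc' : 0 < c⁻¹ := inv_pos.2 hc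
    nlinarith [mul_nonneg hc'.le hM, mul_nonneg hc'.le (hA.trans hAB)]
  split_ifs with h
  · have hc : 0 < √lam := Real.sqrt_pos.2 h
    refine ⟨3 * (1 + (√lam)⁻¹), by positivity, ?_⟩
    filter_upwards [ae_apply_zero_ne_zero] with ζ hζ
    have h1 : (1 + ‖ζ‖) ^ (1 / 2 : ℝ) ≤ (1 + (|ζ 0| + |ζ 1|)) ^ (1 / 2 : ℝ) := by
      gcongr
      exact norm_le_abs_add_abs ζ
    exact (h1.trans (one_add_add_rpow_half_le (abs_pos.2 hζ) (abs_nonneg _))).trans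
      (combine hc (norm_nonneg _) (norm_nonneg _) (Real.sqrt_nonneg _)
        (sqrt_le_norm_symbolDx_half ζ) (mul_div_sqrt_le_norm_symbol hc.le hζ))
  · have hmu0 : 0 < mu := lt_of_le_of_ne hmu fun h0 => hne ⟨by linarith, h0.symm⟩
    have hc : 0 < √mu := Real.sqrt_pos.2 hmu0
    refine ⟨3 * (1 + (√mu)⁻¹), by positivity, ?_⟩
    filter_upwards [ae_apply_zero_ne_zero] with ζ hζ
    have h1 : (1 + ‖ζ‖) ^ (1 / 3 : ℝ) ≤ (1 + (|ζ 0| + |ζ 1|)) ^ (1 / 3 : ℝ) := by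
      gcongr
      exact norm_le_abs_add_abs ζ
    refine (h1.trans (one_add_add_rpow_third_le (abs_pos.2 hζ) (abs_nonneg _))).trans ?_
    rw [add_right_comm (1 + ‖symbolDx (1 / 2) ζ‖)]
    exact combine hc (norm_nonneg _) (norm_nonneg _) (Real.sqrt_nonneg _)
      (sqrt_le_norm_symbolDx_half ζ) (norm_symbolPxInvPy hc.le ζ).ge

theorem mainTheorem7 (lam mu : ℝ) (hlam : 0 ≤ lam) (hmu : 0 ≤ mu)
    (hne : ¬ (lam = 0 ∧ mu = 0)) (p : ℝ) (hp : 0 ≤ p)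
    (hp_pos : 0 < lam → p < 4) (hp_zero : lam = 0 → p < 4 / 3) :
    (∀ f : XHalf lam mu, ∀ R : ℝ, 0 < R →
      MemLp (f.toL2 : Plane → ℂ) (ENNReal.ofReal p) (volume.restrict (Metric.ball 0 R))) ∧
    ∀ u : ℕ → XHalf lam mu, (∃ C : ℝ, ∀ n, ‖u n‖ ≤ C) →
      ∃ φ : ℕ → ℕ, StrictMono φ ∧ ∃ v : Plane → ℂ, ∀ R : ℝ, 0 < R →
        MemLp v (ENNReal.ofReal p) (volume.restrict (Metric.ball 0 R)) ∧
        TendstoLp p (volume.restrict (Metric.ball 0 R))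
          (fun k => ((u (φ k)).toL2 : Plane → ℂ)) v := by
  obtain ⟨D, hD, hw⟩ := exists_weight_bound hlam hmu hne
  set s : ℝ := if 0 < lam then 1 / 2 else 1 / 3 with hs
  obtain ⟨hs0, hs1, hps⟩ : 0 < s ∧ s < 1 ∧ p < 2 / (1 - s) := by
    rw [hs]
    split_ifs with h
    · have := hp_pos h
      norm_num
      exact this
    · have := hp_zero (le_antisymm (not_lt.1 h) hlam)
      norm_num
      linarith
  have hex := XHalf.exists_eq_bessel hD hw
  refine ⟨fun f R _ => ?_, ?_⟩
  · obtain ⟨k, hfk, -⟩ := hex f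
    exact memLp_ball_of_bessel hs0.le hs1 hfk hp hps R
  · rintro u ⟨C, hC⟩
    choose k hfk hkn using fun n => hex (u n)
    obtain ⟨φ, hφ, v, hv⟩ := exists_subseq_tendsto_of_bessel hs0 hs1 hfk
      (fun n => (hkn n).trans (mul_le_mul_of_nonneg_left (hC n) (by positivity))) hp hps
    exact ⟨φ, hφ, v, fun R _ => hv R⟩
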